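/- Let $T>0$, $m\ge 1$, and let $\alpha_0>\alpha_1>\dots>\alpha_m\ge 0$ be real numbers with nonnegative integers $n_i$ such that $n_i-1<\alpha_i\le n_i$ ($i=0,\dots,m$). Let $a_1,\dots,a_m\in C[0,T]$ and consider $${}^cD_{0+}^{\alpha_0}y(t)=-\sum_{i=1}^m a_i(t)\,{}^cD_{0+}^{\alpha_i}y(t),\qquad 0<t<T. \tag{1}$$ Here $I_{0+}^{\beta}f(t)=\frac1{\Gamma(\beta)}\int_0^t(t-\tau)^{\beta-1}f(\tau)\,d\tau$ for $\beta>0$, $I_{0+}^0f=f$, and, for $n-1<\beta\le n$ with $n$ a nonnegative integer, the Caputo derivative is ${}^cD_{0+}^{\beta}f(t)=\frac{d^n}{dt^n}I_{0+}^{n-\beta}\Big[f-\sum_{k=0}^{n-1}\frac{f^{(k)}(0)}{k!}t^k\Big](t)$, $t>0$. Let $C^{\alpha_0,n_0-1}[0,T]$ be the space of all $y\in C^{n_0-1}[0,T]$ with ${}^cD_{0+}^{\alpha_0}y\in C[0,T]$, with the norm $\sum_{k=0}^{n_0-1}\max|y^{(k)}|+\max|{}^cD_{0+}^{\alpha_0}y|$.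 A canonical fundamental system of (1) in this space is a system $y_0,\dots,y_{n_0-1}\in C^{\alpha_0,n_0-1}[0,T]$ of solutions of (1) such that $y_j^{(k)}(0)=1$ if $k=j$ and $0$ if $k\ne j$ ($j,k=0,\dots,n_0-1$). Write $\Phi_s(t)=t^{s-1}/\Gamma(s)$ (so $\Phi_{k+1}(t)=t^k/k!$), $H_j=\{i: 1\le i\le m,\ 0\le\alpha_i\le j\}$, and $h_j=\min H_j$ when $H_j\neq\emptyset$. Assume that $n_0>n_1$, that $n_0\ge 2$, and that there is a $j_0\in\{0,1,\dots,n_0-2\}$ with $H_{j_0}=\emptyset$ and $H_{j_0+1}\ne\emptyset$. Then there exists a unique canonical fundamental system $y_0,\dots,y_{n_0-1}$ of (1) in $C^{\alpha_0,n_0-1}[0,T]$, and $$y_j(t)=\Phi_{j+1}(t),\qquad j=0,1,\dots,j_0;$$ $$y_j(t)=\Phi_{j+1}(t)+\sum_{k=0}^{\infty}(-1)^{k+1}I_{0+}^{\alpha_0}\Big[\sum_{i=1}^m a_i(t)I_{0+}^{\alpha_0-\alpha_i}\Big]^k\sum_{i=h_j}^m a_i(t)\Phi_{j+1-\alpha_i}(t),\qquad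 j_0<j<n_1;$$ $$y_j(t)=\Phi_{j+1}(t)+\sum_{k=0}^{\infty}(-1)^{k+1}I_{0+}^{\alpha_0}\Big[\sum_{i=1}^m a_i(t)I_{0+}^{\alpha_0-\alpha_i}\Big]^k\sum_{i=1}^m a_i(t)\Phi_{j+1-\alpha_i}(t),\qquad n_1\le j\le n_0-1,$$ where the partial sums of the series belong to $C^{\alpha_0,n_0-1}[0,T]$ and converge to $y_j$ in its norm. -/

import Mathlib

open Set Filter Topology

noncomputable section

namespace CaputoFDE

/-- Riemann-Liouville fractional integral of order `β ≥ 0` with base point `0`;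
order `0` is the identity. -/
def fracIntegral (β : ℝ) (f : ℝ → ℝ) (t : ℝ) : ℝ :=
  if β = 0 then f t
  else (Real.Gamma β)⁻¹ * ∫ τ in (0 : ℝ)..t, (t - τ) ^ (β - 1) * f τ

/-- The Riemann-Liouville derivative of order `β` of `f` exists on `(0, T]`: with `n = ⌈β⌉`, the
function `I^(n - β) f` is `n` times differentiable there (one-sidedly at `T`). -/
def RLDifferentiable (T β : ℝ) (f : ℝ → ℝ) : Prop :=
  ∀ k < ⌈β⌉₊, DifferentiableOn ℝ
    (iteratedDerivWithin k (fracIntegral ((⌈β⌉₊ : ℝ) - β) f) (Ioc 0 T)) (Ioc 0 T)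

/-- Riemann-Liouville derivative `d^n/dt^n I^(n - β) f`, `n = ⌈β⌉`, on `(0, T]`. -/
def rlDeriv (T β : ℝ) (f : ℝ → ℝ) (t : ℝ) : ℝ :=
  iteratedDerivWithin ⌈β⌉₊ (fracIntegral ((⌈β⌉₊ : ℝ) - β) f) (Ioc 0 T) t

/-- `f` minus its Taylor polynomial of degree `< n` at `0` (derivatives from the right). -/
def taylorRemainder (T : ℝ) (n : ℕ) (f : ℝ → ℝ) (t : ℝ) : ℝ :=
  f t - ∑ k ∈ Finset.range n, iteratedDerivWithin k f (Icc 0 T) 0 / (k.factorial : ℝ) * t ^ k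

/-- The Caputo derivative of order `β` of `f` exists on `(0, T]`. -/
def CaputoDifferentiable (T β : ℝ) (f : ℝ → ℝ) : Prop :=
  RLDifferentiable T β (taylorRemainder T ⌈β⌉₊ f)

/-- Caputo derivative of order `β ≥ 0` on `(0, T]`: the Riemann-Liouville derivative of `f` minus
its Taylor polynomial of degree `< ⌈β⌉` at `0`. -/
def caputoDeriv (T β : ℝ) (f : ℝ → ℝ) (t : ℝ) : ℝ :=
  rlDeriv T β (taylorRemainder T ⌈β⌉₊ f) t

/-- The space `C^{β, r}[0, T]`: functions in `C^r[0, T]` whose Caputo derivative of order `β`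
exists on `(0, T]` and belongs to `C[0, T]`, that is, extends continuously to `[0, T]`. -/
structure MemCaputoSpace (T β : ℝ) (r : ℕ) (f : ℝ → ℝ) : Prop where
  contDiffOn : ContDiffOn ℝ r f (Icc 0 T)
  caputoDifferentiable : CaputoDifferentiable T β f
  continuous_caputo : ∃ g : ℝ → ℝ, ContinuousOn g (Icc 0 T) ∧ EqOn (caputoDeriv T β f) g (Ioc 0 T)

/-- Convergence in the norm `∑_{k ≤ r} max |f^(k)| + max |ᶜD^β f|` of `C^{β, r}[0, T]`. -/
structure TendstoInCaputoSpace (T β : ℝ) (r : ℕ) (s : ℕ → ℝ → ℝ) (f : ℝ → ℝ) : Prop where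
  mem_seq : ∀ N, MemCaputoSpace T β r (s N)
  mem_lim : MemCaputoSpace T β r f
  deriv : ∀ k ≤ r, TendstoUniformlyOn (fun N => iteratedDerivWithin k (s N) (Icc 0 T))
    (iteratedDerivWithin k f (Icc 0 T)) atTop (Icc 0 T)
  caputo : TendstoUniformlyOn (fun N => caputoDeriv T β (s N)) (caputoDeriv T β f) atTop (Ioc 0 T)

/-- `(y 0, …, y (N - 1))` is a canonical fundamental system, with members in
`C^{α 0, N - 1}[0, T]`, of solutions on `(0, T)` of
`ᶜD^{α 0} y = - ∑_{i=1}^m a i * ᶜD^{α i} y`, where `N = ⌈α 0⌉`. -/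
structure IsCanonicalFundamentalSystem (T : ℝ) (m : ℕ) (α : ℕ → ℝ) (a : ℕ → ℝ → ℝ) (N : ℕ)
    (y : Fin N → ℝ → ℝ) : Prop where
  mem : ∀ j, MemCaputoSpace T (α 0) (N - 1) (y j)
  caputoDifferentiable : ∀ j, ∀ i ≤ m, CaputoDifferentiable T (α i) (y j)
  equation : ∀ j, ∀ t ∈ Ioo 0 T,
    caputoDeriv T (α 0) (y j) t = - ∑ i ∈ Finset.Icc 1 m, a i t * caputoDeriv T (α i) (y j) t
  initial : ∀ j k : Fin N,
    iteratedDerivWithin (k : ℕ) (y j) (Icc 0 T) 0 = if j = k then 1 else 0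

/-- `Φ_s(t) = t^(s-1) / Γ(s)`, so that `Φ_{k+1}(t) = t^k / k!`. -/
def Phi (s t : ℝ) : ℝ := t ^ (s - 1) / Real.Gamma s

/-- The index set `H_j` of the orders `α i`, `1 ≤ i ≤ m`, that do not exceed `j`. -/
def indexSet (m : ℕ) (α : ℕ → ℝ) (j : ℕ) : Set ℕ :=
  {i | 1 ≤ i ∧ i ≤ m ∧ 0 ≤ α i ∧ α i ≤ (j : ℝ)}

/-- `h_j = min H_j` (used only when `H_j` is nonempty). -/
def minIndex (m : ℕ) (α : ℕ → ℝ) (j : ℕ) : ℕ := sInf (indexSet m α j)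

/-- The operator `∑_{i=1}^m a_i(t) I^{α_0 - α_i}`. -/
def coeffOp (m : ℕ) (α : ℕ → ℝ) (a : ℕ → ℝ → ℝ) (f : ℝ → ℝ) (t : ℝ) : ℝ :=
  ∑ i ∈ Finset.Icc 1 m, a i t * fracIntegral (α 0 - α i) f t

/-- The function `∑_{i=p}^m a_i(t) Φ_{j+1-α_i}(t)`. -/
def innerSum (m : ℕ) (α : ℕ → ℝ) (a : ℕ → ℝ → ℝ) (p j : ℕ) (t : ℝ) : ℝ :=
  ∑ i ∈ Finset.Icc p m, a i t * Phi ((j : ℝ) + 1 - α i) t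

/-- Partial sum (over `k < N`) of
`Φ_{j+1} + ∑_k (-1)^(k+1) I^{α_0} [∑_{i=1}^m a_i I^{α_0-α_i}]^k ∑_{i=p}^m a_i Φ_{j+1-α_i}`. -/
def partialSum (m : ℕ) (α : ℕ → ℝ) (a : ℕ → ℝ → ℝ) (p j N : ℕ) (t : ℝ) : ℝ :=
  Phi ((j : ℝ) + 1) t + ∑ k ∈ Finset.range N,
    (-1 : ℝ) ^ (k + 1) * fracIntegral (α 0) ((coeffOp m α a)^[k] (innerSum m α a p j)) t

end CaputoFDE

end

noncomputable section

namespace CaputoFDE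

open MeasureTheory

/-! For `j < ⌈α 0⌉`, the substitution `y = Φ_{j+1} + I^{α 0} g` is a bijection between continuous
`g` and the members of `C^{α 0, n 0 - 1}[0, T]` with the initial data of `t ^ j / j!`; the inverse
is `g = ᶜD^{α 0} y`. One direction is `memCaputoSpace_of_eqOn`, the other
`MemCaputoSpace.exists_eqOn`. By `caputoDeriv_of_eqOn`, `ᶜD^{α i} y` equals `ᶜD^{α i} (t ^ j / j!) +
I^{α 0 - α i} g`, where the first term is `Φ_{j+1-α i}` if `α i ≤ j` and zero otherwise.

Equation (1) thus becomes the Volterra equation `g = -h - A g` with `A = coeffOp m α a` and `h =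
monomialForcing m α a j`. In a weight `exp (r t)` with `r` large, `A` has norm at most `1/2`
(`exists_weight_coeffOp_le`), so the Neumann series converges uniformly to the only solution
(`exists_solution`, `eqOn_of_solution`). The operators `I^{α 0 - k}` preserve uniform convergence,
which yields convergence in the norm of the space.

The three formulas differ only in which `i` satisfy `α i ≤ j`: none for `j ≤ j₀`, those with `i ≥
h_j` for `j₀ < j < n 1`, and all of them for `j ≥ n 1`. -/

/-! ### Fractional integrals: bounds and action on powers. -/

lemma fracIntegral_zero (f : ℝ → ℝ) : fracIntegral 0 f = f := by
  funext t
  simp [fracIntegral]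

lemma fracIntegral_of_ne {β : ℝ} (hβ : β ≠ 0) (f : ℝ → ℝ) (t : ℝ) :
    fracIntegral β f t = (Real.Gamma β)⁻¹ * ∫ τ in (0 : ℝ)..t, (t - τ) ^ (β - 1) * f τ := by
  simp [fracIntegral, hβ]

lemma fracIntegral_apply_zero {β : ℝ} (hβ : β ≠ 0) (f : ℝ → ℝ) : fracIntegral β f 0 = 0 := by
  simp [fracIntegral_of_ne hβ]

lemma fracIntegral_one (f : ℝ → ℝ) (t : ℝ) : fracIntegral 1 f t = ∫ τ in (0 : ℝ)..t, f τ := by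
  simp [fracIntegral]

lemma fracIntegral_congr {T : ℝ} (β : ℝ) {f g : ℝ → ℝ} (h : EqOn f g (Icc 0 T)) :
    EqOn (fracIntegral β f) (fracIntegral β g) (Icc 0 T) := by
  intro t ht
  by_cases hβ : β = 0
  · subst hβ
    simpa [fracIntegral_zero] using h ht
  · rw [fracIntegral_of_ne hβ, fracIntegral_of_ne hβ]
    congr 1
    refine intervalIntegral.integral_congr fun τ hτ => ?_
    rw [uIcc_of_le ht.1] at hτ
    simp only [h ⟨hτ.1, hτ.2.trans ht.2⟩]

lemma intervalIntegrable_sub_rpow {β : ℝ} (hβ : 0 < β) (t : ℝ) :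
    IntervalIntegrable (fun τ : ℝ => (t - τ) ^ (β - 1)) volume 0 t := by
  have h := (intervalIntegral.intervalIntegrable_rpow' (a := t) (b := 0) (r := β - 1)
    (by linarith)).comp_sub_left t
  simpa using h

lemma intervalIntegrable_kernel_mul {T β : ℝ} (hβ : 0 < β) {f : ℝ → ℝ}
    (hf : ContinuousOn f (Icc 0 T)) {t : ℝ} (ht : t ∈ Icc 0 T) :
    IntervalIntegrable (fun τ : ℝ => (t - τ) ^ (β - 1) * f τ) volume 0 t := by
  refine (intervalIntegrable_sub_rpow hβ t).mul_continuousOn (hf.mono ?_)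
  rw [uIcc_of_le ht.1]
  exact Icc_subset_Icc le_rfl ht.2

/-- Weighted (Bielecki) estimate: `I^β` has norm at most `r^(-β)` for the weight `exp (r t)`. -/
lemma abs_fracIntegral_le {β r M t : ℝ} (hβ : 0 ≤ β) (hr : 0 < r) (ht : 0 ≤ t) {f : ℝ → ℝ}
    (hf : ∀ τ ∈ Icc 0 t, |f τ| ≤ M * Real.exp (r * τ)) :
    |fracIntegral β f t| ≤ M * Real.exp (r * t) * (1 / r) ^ β := by
  rcases hβ.eq_or_lt with rfl | hβ
  · simpa [fracIntegral_zero] using hf t ⟨ht, le_rfl⟩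
  have hM : 0 ≤ M := by
    have := (abs_nonneg _).trans (hf 0 ⟨le_rfl, ht⟩)
    simpa using this
  have hG := Real.Gamma_pos_of_pos hβ
  have hint : IntegrableOn (fun s : ℝ => s ^ (β - 1) * Real.exp (-(r * s))) (Ioi 0) := by
    have := integrableOn_rpow_mul_exp_neg_mul_rpow (p := 1) (s := β - 1) (b := r) (by linarith)
      one_pos hr
    simpa using this
  -- Substituting `s = t - τ` pulls out `exp (r t)` and leaves a truncated Gamma integral, at most
  -- `r^(-β) Γ(β)`.
  have hI : (∫ τ in (0 : ℝ)..t, (t - τ) ^ (β - 1) * (M * Real.exp (r * τ)))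
      = M * Real.exp (r * t) * ∫ s in (0 : ℝ)..t, s ^ (β - 1) * Real.exp (-(r * s)) := by
    have h := intervalIntegral.integral_comp_sub_left (a := 0) (b := t)
      (fun s => s ^ (β - 1) * Real.exp (-(r * s))) t
    simp only [sub_self, sub_zero] at h
    rw [← h, ← intervalIntegral.integral_const_mul]
    refine intervalIntegral.integral_congr fun τ _ => ?_
    have : Real.exp (r * τ) = Real.exp (r * t) * Real.exp (-(r * (t - τ))) := by
      rw [← Real.exp_add]; ring_nf
    simp only [this]
    ring
  have hle : (∫ s in (0 : ℝ)..t, s ^ (β - 1) * Real.exp (-(r * s)))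
      ≤ (1 / r) ^ β * Real.Gamma β := by
    rw [← Real.integral_rpow_mul_exp_neg_mul_Ioi hβ hr, intervalIntegral.integral_of_le ht]
    refine setIntegral_mono_set hint ?_ (Ioc_subset_Ioi_self.eventuallyLE)
    filter_upwards [ae_restrict_mem measurableSet_Ioi] with s hs
    exact mul_nonneg (Real.rpow_nonneg (le_of_lt hs) _) (Real.exp_pos _).le
  have hb : |∫ τ in (0 : ℝ)..t, (t - τ) ^ (β - 1) * f τ|
      ≤ ∫ τ in (0 : ℝ)..t, (t - τ) ^ (β - 1) * (M * Real.exp (r * τ)) := by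
    rw [← Real.norm_eq_abs]
    refine intervalIntegral.norm_integral_le_of_norm_le ht (ae_of_all _ fun τ hτ => ?_) ?_
    · have hk : 0 ≤ (t - τ) ^ (β - 1) := Real.rpow_nonneg (by linarith [hτ.2]) _
      rw [norm_mul, Real.norm_of_nonneg hk, Real.norm_eq_abs]
      exact mul_le_mul_of_nonneg_left (hf τ ⟨hτ.1.le, hτ.2⟩) hk
    · exact intervalIntegrable_kernel_mul (T := t) hβ (by fun_prop) ⟨ht, le_rfl⟩
  rw [fracIntegral_of_ne hβ.ne', abs_mul, abs_of_pos (inv_pos.2 hG), inv_mul_le_iff₀ hG]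
  rw [hI] at hb
  refine hb.trans ((mul_le_mul_of_nonneg_left hle (by positivity)).trans_eq (by ring))

/-- The weighted estimate with `r = 1`: a crude sup-norm bound, uniform in `β`, which suffices for
uniform convergence. -/
lemma abs_fracIntegral_le_of_abs_le {T β M t : ℝ} (hβ : 0 ≤ β) (ht : t ∈ Icc 0 T) {f : ℝ → ℝ}
    (hf : ∀ τ ∈ Icc 0 T, |f τ| ≤ M) : |fracIntegral β f t| ≤ M * Real.exp T := by
  have hM : 0 ≤ M := (abs_nonneg _).trans (hf t ht)
  have h := abs_fracIntegral_le (β := β) (r := 1) (M := M) (f := f) hβ one_pos ht.1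
    fun τ hτ => (hf τ ⟨hτ.1, hτ.2.trans ht.2⟩).trans
      (le_mul_of_one_le_right hM (Real.one_le_exp (by simpa using hτ.1)))
  simp only [one_mul, div_one, Real.one_rpow, mul_one] at h
  exact h.trans (mul_le_mul_of_nonneg_left (Real.exp_le_exp.2 ht.2) hM)

/-- Euler's Beta integral scaled to `[0, t]`, read off from its complex form. -/
lemma integral_sub_rpow_mul_rpow {β s t : ℝ} (hβ : 0 < β) (hs : 0 < s) (ht : 0 < t) :
    ∫ τ in (0 : ℝ)..t, (t - τ) ^ (β - 1) * τ ^ (s - 1)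
      = t ^ (s + β - 1) * (Real.Gamma s * Real.Gamma β / Real.Gamma (s + β)) := by
  have h := Complex.betaIntegral_scaled (s : ℂ) (β : ℂ) ht
  have h2 := Complex.betaIntegral_eq_Gamma_mul_div (s : ℂ) (β : ℂ) (by simpa) (by simpa)
  have h3 : (∫ x in (0 : ℝ)..t, (x : ℂ) ^ ((s : ℂ) - 1) * ((t : ℂ) - x) ^ ((β : ℂ) - 1))
      = ((∫ τ in (0 : ℝ)..t, (t - τ) ^ (β - 1) * τ ^ (s - 1) : ℝ) : ℂ) := by
    rw [← intervalIntegral.integral_ofReal]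
    refine intervalIntegral.integral_congr fun τ hτ => ?_
    rw [uIcc_of_le ht.le] at hτ
    rw [Complex.ofReal_mul, Complex.ofReal_cpow hτ.1, Complex.ofReal_cpow (by linarith [hτ.2])]
    push_cast
    ring
  rw [h3, h2] at h
  have h4 : (t : ℂ) ^ ((s : ℂ) + β - 1) = ((t ^ (s + β - 1) : ℝ) : ℂ) := by
    rw [Complex.ofReal_cpow ht.le]; push_cast; rfl
  rw [h4, ← Complex.ofReal_add, Complex.Gamma_ofReal, Complex.Gamma_ofReal,
    Complex.Gamma_ofReal] at h
  exact_mod_cast h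

lemma fracIntegral_Phi {β s t : ℝ} (hβ : 0 ≤ β) (hs : 1 ≤ s) (ht : 0 ≤ t) :
    fracIntegral β (Phi s) t = Phi (s + β) t := by
  rcases hβ.eq_or_lt with rfl | hβ
  · simp [fracIntegral_zero]
  rcases ht.eq_or_lt with rfl | ht
  · rw [fracIntegral_apply_zero hβ.ne', Phi, Real.zero_rpow (by linarith), zero_div]
  have hG := (Real.Gamma_pos_of_pos hβ).ne'
  have hG2 := (Real.Gamma_pos_of_pos (show 0 < s by linarith)).ne'
  rw [fracIntegral_of_ne hβ.ne']
  have : ∀ τ, (t - τ) ^ (β - 1) * Phi s τ = ((t - τ) ^ (β - 1) * τ ^ (s - 1)) * (Real.Gamma s)⁻¹ :=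
    fun τ => by rw [Phi]; ring
  simp_rw [this]
  rw [intervalIntegral.integral_mul_const, integral_sub_rpow_mul_rpow hβ (by linarith) ht, Phi]
  field_simp

lemma continuous_Phi {s : ℝ} (hs : 1 ≤ s) : Continuous (Phi s) :=
  (Real.continuous_rpow_const (by linarith)).div_const _

lemma hasDerivAt_Phi {s : ℝ} (hs : 1 ≤ s) (t : ℝ) : HasDerivAt (Phi (s + 1)) (Phi s t) t := by
  have h := (Real.hasDerivAt_rpow_const (x := t) (p := s) (Or.inr hs)).div_const
    (Real.Gamma (s + 1))
  have e : Phi (s + 1) = fun x => x ^ s / Real.Gamma (s + 1) := by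
    funext x; simp [Phi]
  rw [e]
  refine h.congr_deriv ?_
  rw [Phi, Real.Gamma_add_one (by linarith)]
  have hG2 := (Real.Gamma_pos_of_pos (show 0 < s by linarith)).ne'
  have : s ≠ 0 := by linarith
  field_simp

lemma Phi_one (t : ℝ) : Phi 1 t = 1 := by simp [Phi]

lemma Phi_zero_of_one_lt {s : ℝ} (hs : 1 < s) : Phi s 0 = 0 := by
  rw [Phi, Real.zero_rpow (by linarith), zero_div]

lemma Phi_natCast_add_one (k : ℕ) (t : ℝ) : Phi ((k : ℝ) + 1) t = t ^ k / (k.factorial : ℝ) := by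
  rw [Phi, Real.Gamma_nat_eq_factorial, add_sub_cancel_right, Real.rpow_natCast]

/-! ### Linearity, continuity, semigroup law and differentiation of fractional integrals. -/

lemma fracIntegral_finset_sum {T β : ℝ} (hβ : 0 ≤ β) {ι : Type*} (S : Finset ι) (c : ι → ℝ)
    {f : ι → ℝ → ℝ} (hf : ∀ i ∈ S, ContinuousOn (f i) (Icc 0 T)) {t : ℝ} (ht : t ∈ Icc 0 T) :
    fracIntegral β (fun τ => ∑ i ∈ S, c i * f i τ) t = ∑ i ∈ S, c i * fracIntegral β (f i) t := by
  rcases hβ.eq_or_lt with rfl | hβ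
  · simp [fracIntegral_zero]
  simp_rw [fracIntegral_of_ne hβ.ne', Finset.mul_sum]
  rw [intervalIntegral.integral_finsetSum, Finset.mul_sum]
  · refine Finset.sum_congr rfl fun i _ => ?_
    rw [← mul_left_comm, ← intervalIntegral.integral_const_mul (c i)]
    simp_rw [mul_left_comm]
  · exact fun i hi => intervalIntegrable_kernel_mul hβ (continuousOn_const.mul (hf i hi)) ht

lemma fracIntegral_add {T β : ℝ} (hβ : 0 ≤ β) {f g : ℝ → ℝ} (hf : ContinuousOn f (Icc 0 T))
    (hg : ContinuousOn g (Icc 0 T)) {t : ℝ} (ht : t ∈ Icc 0 T) :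
    fracIntegral β (fun τ => f τ + g τ) t = fracIntegral β f t + fracIntegral β g t := by
  have h := fracIntegral_finset_sum hβ (Finset.univ : Finset (Fin 2)) (fun _ => 1)
    (f := ![f, g]) (by simp [hf, hg]) ht
  simpa using h

lemma fracIntegral_sub {T β : ℝ} (hβ : 0 ≤ β) {f g : ℝ → ℝ} (hf : ContinuousOn f (Icc 0 T))
    (hg : ContinuousOn g (Icc 0 T)) {t : ℝ} (ht : t ∈ Icc 0 T) :
    fracIntegral β (fun τ => f τ - g τ) t = fracIntegral β f t - fracIntegral β g t := by
  have h := fracIntegral_finset_sum hβ (Finset.univ : Finset (Fin 2)) ![1, -1]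
    (f := ![f, g]) (by simp [hf, hg]) ht
  simpa [sub_eq_add_neg] using h

lemma fracIntegral_polynomial {β : ℝ} (hβ : 0 ≤ β) (p : Polynomial ℝ) {t : ℝ} (ht : 0 ≤ t) :
    fracIntegral β (fun τ => p.eval τ) t
      = ∑ k ∈ Finset.range (p.natDegree + 1),
        (p.coeff k * (k.factorial : ℝ)) * Phi ((k : ℝ) + 1 + β) t := by
  have e : (fun τ => p.eval τ) = fun τ => ∑ k ∈ Finset.range (p.natDegree + 1),
      (p.coeff k * (k.factorial : ℝ)) * Phi ((k : ℝ) + 1) τ := by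
    funext τ
    rw [Polynomial.eval_eq_sum_range]
    refine Finset.sum_congr rfl fun k _ => ?_
    rw [Phi_natCast_add_one]
    have : (k.factorial : ℝ) ≠ 0 := by positivity
    field_simp
  have h1 (k : ℕ) : 1 ≤ (k : ℝ) + 1 := by linarith [k.cast_nonneg (α := ℝ)]
  rw [e, fracIntegral_finset_sum (T := t) hβ _ _ (fun k _ => (continuous_Phi (h1 k)).continuousOn)
    ⟨ht, le_rfl⟩]
  exact Finset.sum_congr rfl fun k _ => by rw [fracIntegral_Phi hβ (h1 k) ht]

lemma fracIntegral_fracIntegral_polynomial {β γ : ℝ} (hβ : 0 ≤ β) (hγ : 0 ≤ γ) (p : Polynomial ℝ)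
    {t : ℝ} (ht : 0 ≤ t) :
    fracIntegral β (fracIntegral γ (fun τ => p.eval τ)) t
      = fracIntegral (β + γ) (fun τ => p.eval τ) t := by
  have h1 (k : ℕ) : 1 ≤ (k : ℝ) + 1 + γ := by linarith [k.cast_nonneg (α := ℝ)]
  have e : EqOn (fracIntegral γ (fun τ => p.eval τ)) _ (Icc 0 t) :=
    fun τ hτ => fracIntegral_polynomial hγ p hτ.1
  rw [fracIntegral_congr β e ⟨ht, le_rfl⟩, fracIntegral_polynomial (add_nonneg hβ hγ) p ht,
    fracIntegral_finset_sum (T := t) hβ _ _ (fun k _ => (continuous_Phi (h1 k)).continuousOn)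
      ⟨ht, le_rfl⟩]
  refine Finset.sum_congr rfl fun k _ => ?_
  rw [fracIntegral_Phi hβ (h1 k) ht]
  ring_nf

lemma tendstoUniformlyOn_fracIntegral {T β : ℝ} (hβ : 0 ≤ β) {ι : Type*} {l : Filter ι}
    {F : ι → ℝ → ℝ} {f : ℝ → ℝ} (hF : ∀ i, ContinuousOn (F i) (Icc 0 T))
    (hf : ContinuousOn f (Icc 0 T)) (h : TendstoUniformlyOn F f l (Icc 0 T)) :
    TendstoUniformlyOn (fun i => fracIntegral β (F i)) (fracIntegral β f) l (Icc 0 T) := by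
  rw [Metric.tendstoUniformlyOn_iff] at h ⊢
  intro ε hε
  have hE := Real.exp_pos T
  filter_upwards [h (ε / 2 / Real.exp T) (by positivity)] with i hi t ht
  rw [Real.dist_eq, ← fracIntegral_sub hβ hf (hF i) ht]
  refine (abs_fracIntegral_le_of_abs_le hβ ht fun τ hτ => (hi τ hτ).le).trans_lt ?_
  rw [div_mul_cancel₀ _ hE.ne']
  linarith

lemma exists_polynomial_tendstoUniformlyOn {T : ℝ} {f : ℝ → ℝ} (hf : ContinuousOn f (Icc 0 T)) :
    ∃ p : ℕ → Polynomial ℝ,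
      TendstoUniformlyOn (fun n τ => (p n).eval τ) f atTop (Icc 0 T) := by
  choose p hp using fun n : ℕ =>
    exists_polynomial_near_of_continuousOn 0 T f hf (1 / ((n : ℝ) + 1)) (by positivity)
  refine ⟨p, Metric.tendstoUniformlyOn_iff.2 fun ε hε => ?_⟩
  filter_upwards [(tendsto_one_div_add_atTop_nhds_zero_nat (𝕜 := ℝ)).eventually_lt_const hε]
    with n hn t ht
  rw [dist_comm, Real.dist_eq]
  exact (hp n t ht).trans hn

/-- By Weierstrass, `I^β f` is a uniform limit of images of polynomials, and these are finite
combinations of continuous `Φ_s`. -/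
lemma continuousOn_fracIntegral {T β : ℝ} (hβ : 0 ≤ β) {f : ℝ → ℝ}
    (hf : ContinuousOn f (Icc 0 T)) : ContinuousOn (fracIntegral β f) (Icc 0 T) := by
  obtain ⟨p, hp⟩ := exists_polynomial_tendstoUniformlyOn hf
  refine (tendstoUniformlyOn_fracIntegral hβ (fun n => (p n).continuous.continuousOn) hf
    hp).continuousOn (Frequently.of_forall fun n => ?_)
  refine ContinuousOn.congr ?_ fun t ht => fracIntegral_polynomial hβ (p n) ht.1
  refine continuousOn_finsetSum _ fun k _ => continuousOn_const.mul
    (continuous_Phi ?_).continuousOn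
  linarith [k.cast_nonneg (α := ℝ)]

/-- Density replaces Fubini: the law holds for polynomials by the action on `Φ_s`, and both sides
are continuous under uniform convergence. -/
lemma fracIntegral_fracIntegral {T β γ : ℝ} (hβ : 0 ≤ β) (hγ : 0 ≤ γ) {f : ℝ → ℝ}
    (hf : ContinuousOn f (Icc 0 T)) :
    EqOn (fracIntegral β (fracIntegral γ f)) (fracIntegral (β + γ) f) (Icc 0 T) := by
  obtain ⟨p, hp⟩ := exists_polynomial_tendstoUniformlyOn hf
  have hc (n : ℕ) : ContinuousOn (fun τ => (p n).eval τ) (Icc 0 T) :=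
    (p n).continuous.continuousOn
  have h1 := tendstoUniformlyOn_fracIntegral (add_nonneg hβ hγ) hc hf hp
  have h2 := tendstoUniformlyOn_fracIntegral hβ (fun n => continuousOn_fracIntegral hγ (hc n))
    (continuousOn_fracIntegral hγ hf) (tendstoUniformlyOn_fracIntegral hγ hc hf hp)
  intro t ht
  refine tendsto_nhds_unique (h2.tendsto_at ht) ((h1.tendsto_at ht).congr fun n => ?_)
  rw [fracIntegral_fracIntegral_polynomial hβ hγ (p n) ht.1]

lemma hasDerivWithinAt_fracIntegral_one {T : ℝ} {f : ℝ → ℝ} (hf : ContinuousOn f (Icc 0 T))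
    {t : ℝ} (ht : t ∈ Icc 0 T) :
    HasDerivWithinAt (fracIntegral 1 f) (f t) (Icc 0 T) t := by
  have e : fracIntegral 1 f = fun u => ∫ τ in (0 : ℝ)..u, f τ := by
    funext u; exact fracIntegral_one f u
  rw [e]
  have hi : IntervalIntegrable f volume 0 t := by
    refine (hf.mono ?_).intervalIntegrable
    rw [uIcc_of_le ht.1]
    exact Icc_subset_Icc le_rfl ht.2
  have : Fact (t ∈ Icc 0 T) := ⟨ht⟩
  exact intervalIntegral.integral_hasDerivWithinAt_right hi
    (hf.stronglyMeasurableAtFilter_nhdsWithin measurableSet_Icc t) (hf t ht)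

lemma hasDerivWithinAt_fracIntegral {T β : ℝ} (hβ : 0 ≤ β) {f : ℝ → ℝ}
    (hf : ContinuousOn f (Icc 0 T)) {t : ℝ} (ht : t ∈ Icc 0 T) :
    HasDerivWithinAt (fracIntegral (β + 1) f) (fracIntegral β f t) (Icc 0 T) t := by
  have e := fracIntegral_fracIntegral zero_le_one hβ hf
  rw [add_comm] at e
  exact (hasDerivWithinAt_fracIntegral_one (continuousOn_fracIntegral hβ hf) ht).congr
    (fun x hx => (e hx).symm) (e ht).symm

/-! ### Iterated derivatives, monomials and Taylor remainders. -/

/-- Used with `S = [0, T]` for ordinary derivatives and with `S = (0, T]` for Riemann-Liouville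
ones. -/
lemma eqOn_iteratedDerivWithin_of_hasDerivWithinAt {S : Set ℝ} (hS : UniqueDiffOn ℝ S) {n : ℕ}
    {f : ℝ → ℝ} {F : ℕ → ℝ → ℝ} (hf : EqOn f (F 0) S)
    (hF : ∀ k < n, ∀ t ∈ S, HasDerivWithinAt (F k) (F (k + 1) t) S t) :
    ∀ k ≤ n, EqOn (iteratedDerivWithin k f S) (F k) S := by
  intro k
  induction k with
  | zero => intro _; rwa [iteratedDerivWithin_zero]
  | succ k ih =>
    intro hk t ht
    have h := ih (by omega)
    rw [iteratedDerivWithin_succ]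
    exact ((hF k (by omega) t ht).congr h (h ht)).derivWithin (hS t ht)

lemma differentiableOn_iteratedDerivWithin_of_hasDerivWithinAt {S : Set ℝ}
    (hS : UniqueDiffOn ℝ S) {n : ℕ} {f : ℝ → ℝ} {F : ℕ → ℝ → ℝ} (hf : EqOn f (F 0) S)
    (hF : ∀ k < n, ∀ t ∈ S, HasDerivWithinAt (F k) (F (k + 1) t) S t) :
    ∀ k < n, DifferentiableOn ℝ (iteratedDerivWithin k f S) S := by
  intro k hk t ht
  have h := eqOn_iteratedDerivWithin_of_hasDerivWithinAt hS hf hF k hk.le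
  exact ((hF k hk t ht).congr h (h ht)).differentiableWithinAt

lemma uniqueDiffOn_Ioc {T : ℝ} : UniqueDiffOn ℝ (Ioc 0 T) :=
  _root_.uniqueDiffOn_Ioc 0 T

/-- The derivative of order `β` of `t ^ j / j!` in the sense of Caputo. -/
def monomialDeriv (j : ℕ) (β t : ℝ) : ℝ :=
  if β ≤ (j : ℝ) then Phi ((j : ℝ) + 1 - β) t else 0

lemma continuous_monomialDeriv (j : ℕ) (β : ℝ) : Continuous (monomialDeriv j β) := by
  by_cases h : β ≤ (j : ℝ)
  · have e : monomialDeriv j β = Phi ((j : ℝ) + 1 - β) := by funext t; simp [monomialDeriv, h]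
    rw [e]
    exact continuous_Phi (by linarith)
  · have e : monomialDeriv j β = fun _ => 0 := by funext t; simp [monomialDeriv, h]
    rw [e]
    exact continuous_const

lemma hasDerivAt_monomialDeriv (j k : ℕ) (t : ℝ) :
    HasDerivAt (monomialDeriv j (k : ℝ)) (monomialDeriv j ((k + 1 : ℕ) : ℝ) t) t := by
  rcases lt_trichotomy k j with h | rfl | h
  · have h1 : ((k : ℝ)) + 1 ≤ j := by exact_mod_cast h
    have e : monomialDeriv j (k : ℝ) = Phi ((j : ℝ) - k + 1) := by
      funext t
      rw [monomialDeriv, if_pos (by linarith)]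
      ring_nf
    rw [e, monomialDeriv, if_pos (by push_cast; linarith)]
    refine (hasDerivAt_Phi (by linarith) t).congr_deriv ?_
    push_cast
    ring_nf
  · have e : monomialDeriv k (k : ℝ) = fun _ => 1 := by
      funext t
      rw [monomialDeriv, if_pos le_rfl, add_sub_cancel_left, Phi_one]
    rw [e, monomialDeriv, if_neg (by push_cast; linarith)]
    exact hasDerivAt_const _ _
  · have h1 : (j : ℝ) < k := by exact_mod_cast h
    have e : monomialDeriv j (k : ℝ) = fun _ => 0 := by
      funext t
      rw [monomialDeriv, if_neg (by linarith)]
    rw [e, monomialDeriv, if_neg (by push_cast; linarith)]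
    exact hasDerivAt_const _ _

lemma monomialDeriv_natCast_zero (j k : ℕ) :
    monomialDeriv j (k : ℝ) 0 = if k = j then 1 else 0 := by
  rcases lt_trichotomy k j with h | rfl | h
  · have h1 : ((k : ℝ)) < j := by exact_mod_cast h
    rw [monomialDeriv, if_pos h1.le, if_neg h.ne, Phi_zero_of_one_lt (by linarith)]
  · rw [monomialDeriv, if_pos le_rfl, if_pos rfl, add_sub_cancel_left, Phi_one]
  · have h1 : (j : ℝ) < k := by exact_mod_cast h
    rw [monomialDeriv, if_neg (by linarith), if_neg h.ne']

lemma monomialDeriv_zero (j : ℕ) (t : ℝ) : monomialDeriv j 0 t = Phi ((j : ℝ) + 1) t := by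
  rw [monomialDeriv, if_pos j.cast_nonneg, sub_zero]

lemma taylorRemainder_eq {T : ℝ} {ν j : ℕ} {f : ℝ → ℝ}
    (h : ∀ k < ν, iteratedDerivWithin k f (Icc 0 T) 0 = if k = j then 1 else 0) (t : ℝ) :
    taylorRemainder T ν f t = f t - if j < ν then Phi ((j : ℝ) + 1) t else 0 := by
  rw [taylorRemainder]
  congr 1
  have e : ∀ k ∈ Finset.range ν, iteratedDerivWithin k f (Icc 0 T) 0 / (k.factorial : ℝ) * t ^ k
      = if j = k then Phi ((k : ℝ) + 1) t else 0 := by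
    intro k hk
    rw [h k (Finset.mem_range.1 hk), Phi_natCast_add_one]
    by_cases hkj : k = j
    · rw [if_pos hkj, if_pos hkj.symm]; ring
    · rw [if_neg hkj, if_neg (Ne.symm hkj)]; ring
  rw [Finset.sum_congr rfl e, Finset.sum_ite_eq]
  simp

/-! ### Functions of the form `Φ_{j+1} + I^{α₀} g`. -/

section Representation

variable {T α₀ : ℝ} {j : ℕ} {f g : ℝ → ℝ}

lemma hasDerivWithinAt_monomialDeriv_add (hg : ContinuousOn g (Icc 0 T)) {k : ℕ}
    (hk : (k : ℝ) + 1 ≤ α₀) {t : ℝ} (ht : t ∈ Icc 0 T) :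
    HasDerivWithinAt (fun t => monomialDeriv j (k : ℝ) t + fracIntegral (α₀ - (k : ℝ)) g t)
      (monomialDeriv j ((k + 1 : ℕ) : ℝ) t + fracIntegral (α₀ - ((k + 1 : ℕ) : ℝ)) g t)
      (Icc 0 T) t := by
  refine (hasDerivAt_monomialDeriv j k t).hasDerivWithinAt.add ?_
  have h := hasDerivWithinAt_fracIntegral (β := α₀ - ((k + 1 : ℕ) : ℝ))
    (by push_cast; linarith) hg ht
  rwa [show α₀ - ((k + 1 : ℕ) : ℝ) + 1 = α₀ - (k : ℝ) by push_cast; ring] at h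

lemma natCast_lt_of_lt_ceil {k : ℕ} (hk : k < ⌈α₀⌉₊) : (k : ℝ) < α₀ := Nat.lt_ceil.1 hk

lemma eqOn_iteratedDerivWithin (hT : 0 < T) (hg : ContinuousOn g (Icc 0 T))
    (hf : EqOn f (fun t => Phi ((j : ℝ) + 1) t + fracIntegral α₀ g t) (Icc 0 T))
    {k : ℕ} (hk : k < ⌈α₀⌉₊) :
    EqOn (iteratedDerivWithin k f (Icc 0 T))
      (fun t => monomialDeriv j (k : ℝ) t + fracIntegral (α₀ - (k : ℝ)) g t) (Icc 0 T) := by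
  refine eqOn_iteratedDerivWithin_of_hasDerivWithinAt (uniqueDiffOn_Icc hT) (n := k)
    (F := fun k t => monomialDeriv j (k : ℝ) t + fracIntegral (α₀ - (k : ℝ)) g t)
    ?_ ?_ k le_rfl
  · intro t ht
    simp only [Nat.cast_zero, monomialDeriv_zero, sub_zero]
    exact hf ht
  · intro i hi t ht
    refine hasDerivWithinAt_monomialDeriv_add hg ?_ ht
    have := natCast_lt_of_lt_ceil (α₀ := α₀) (k := i + 1) (by omega)
    push_cast at this
    exact this.le

lemma contDiffOn_of_eqOn (hT : 0 < T) (hα : 0 < α₀) (hg : ContinuousOn g (Icc 0 T))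
    (hf : EqOn f (fun t => Phi ((j : ℝ) + 1) t + fracIntegral α₀ g t) (Icc 0 T)) :
    ContDiffOn ℝ ((⌈α₀⌉₊ - 1 : ℕ) : WithTop ℕ∞) f (Icc 0 T) := by
  have hpos := Nat.ceil_pos.2 hα
  rw [contDiffOn_nat_iff_continuousOn_differentiableOn_deriv (uniqueDiffOn_Icc hT)]
  constructor
  · intro k hk
    have hk' : k < ⌈α₀⌉₊ := by omega
    refine ContinuousOn.congr ?_ (eqOn_iteratedDerivWithin hT hg hf hk')
    exact (continuous_monomialDeriv _ _).continuousOn.add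
      (continuousOn_fracIntegral (by linarith [natCast_lt_of_lt_ceil hk']) hg)
  · intro k hk t ht
    have hk' : k + 1 < ⌈α₀⌉₊ := by omega
    have h := eqOn_iteratedDerivWithin (k := k) hT hg hf (by omega)
    have := natCast_lt_of_lt_ceil hk'
    push_cast at this
    exact ((hasDerivWithinAt_monomialDeriv_add hg this.le ht).congr h (h ht)).differentiableWithinAt

lemma iteratedDerivWithin_zero_of_eqOn (hT : 0 < T) (hg : ContinuousOn g (Icc 0 T))
    (hf : EqOn f (fun t => Phi ((j : ℝ) + 1) t + fracIntegral α₀ g t) (Icc 0 T))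
    {k : ℕ} (hk : k < ⌈α₀⌉₊) :
    iteratedDerivWithin k f (Icc 0 T) 0 = if k = j then 1 else 0 := by
  rw [eqOn_iteratedDerivWithin hT hg hf hk ⟨le_rfl, hT.le⟩]
  have := natCast_lt_of_lt_ceil hk
  simp only
  rw [monomialDeriv_natCast_zero, fracIntegral_apply_zero (by linarith), add_zero]

/-- The Taylor polynomial of degree `< ⌈β⌉` is `Φ_{j+1}` itself if `j < ⌈β⌉` and zero otherwise; the
semigroup law does the rest. -/
lemma rlIntegral_taylorRemainder_eqOn (hT : 0 < T) (hg : ContinuousOn g (Icc 0 T))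
    (hf : EqOn f (fun t => Phi ((j : ℝ) + 1) t + fracIntegral α₀ g t) (Icc 0 T))
    {β : ℝ} (hβ : 0 ≤ β) (hβα : β ≤ α₀) :
    EqOn (fracIntegral ((⌈β⌉₊ : ℝ) - β) (taylorRemainder T ⌈β⌉₊ f))
      (fun t => (if j < ⌈β⌉₊ then 0 else Phi ((j : ℝ) + 1 + ((⌈β⌉₊ : ℝ) - β)) t)
        + fracIntegral ((⌈β⌉₊ : ℝ) - β + α₀) g t) (Icc 0 T) := by
  have hν : 0 ≤ (⌈β⌉₊ : ℝ) - β := sub_nonneg.2 (Nat.le_ceil β)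
  have hα : 0 ≤ α₀ := hβ.trans hβα
  have hj : 1 ≤ (j : ℝ) + 1 := by linarith [j.cast_nonneg (α := ℝ)]
  have hle : ⌈β⌉₊ ≤ ⌈α₀⌉₊ := Nat.ceil_le_ceil hβα
  have hr (t : ℝ) := taylorRemainder_eq (T := T) (j := j) (ν := ⌈β⌉₊) (f := f)
    (fun k hk => iteratedDerivWithin_zero_of_eqOn hT hg hf (hk.trans_le hle)) t
  intro t ht
  by_cases h : j < ⌈β⌉₊
  · have e : EqOn (taylorRemainder T ⌈β⌉₊ f) (fracIntegral α₀ g) (Icc 0 T) := by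
      intro τ hτ
      rw [hr, hf hτ, if_pos h]
      ring
    rw [fracIntegral_congr _ e ht, fracIntegral_fracIntegral hν hα hg ht]
    simp [h]
  · have e : EqOn (taylorRemainder T ⌈β⌉₊ f)
        (fun τ => Phi ((j : ℝ) + 1) τ + fracIntegral α₀ g τ) (Icc 0 T) := by
      intro τ hτ
      rw [hr, hf hτ, if_neg h]
      ring
    rw [fracIntegral_congr _ e ht, fracIntegral_add hν (continuous_Phi hj).continuousOn
      (continuousOn_fracIntegral hα hg) ht, fracIntegral_fracIntegral hν hα hg ht,
      fracIntegral_Phi hν hj ht.1]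
    simp [h]

/-- Each derivative lowers both indices by one. For `k < ⌈β⌉` the new integral order stays at least
`α₀ - β ≥ 0`, and when `Φ` is present its index stays at least `1`. -/
lemma hasDerivWithinAt_rlIntegral (hg : ContinuousOn g (Icc 0 T)) {β : ℝ} (hβα : β ≤ α₀) {k : ℕ}
    (hk : k < ⌈β⌉₊) {t : ℝ} (ht : t ∈ Icc 0 T) :
    HasDerivWithinAt (fun t => (if j < ⌈β⌉₊ then 0
        else Phi ((j : ℝ) + 1 + ((⌈β⌉₊ : ℝ) - β) - (k : ℝ)) t)
        + fracIntegral ((⌈β⌉₊ : ℝ) - β + α₀ - (k : ℝ)) g t)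
      ((if j < ⌈β⌉₊ then 0
        else Phi ((j : ℝ) + 1 + ((⌈β⌉₊ : ℝ) - β) - ((k + 1 : ℕ) : ℝ)) t)
        + fracIntegral ((⌈β⌉₊ : ℝ) - β + α₀ - ((k + 1 : ℕ) : ℝ)) g t) (Icc 0 T) t := by
  have hν : 0 ≤ (⌈β⌉₊ : ℝ) - β := sub_nonneg.2 (Nat.le_ceil β)
  have hk1 : (k : ℝ) + 1 ≤ ⌈β⌉₊ := by exact_mod_cast hk
  have h2 := hasDerivWithinAt_fracIntegral (β := (⌈β⌉₊ : ℝ) - β + α₀ - ((k + 1 : ℕ) : ℝ))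
    (by push_cast; linarith) hg ht
  rw [show (⌈β⌉₊ : ℝ) - β + α₀ - ((k + 1 : ℕ) : ℝ) + 1 = (⌈β⌉₊ : ℝ) - β + α₀ - (k : ℝ) by
    push_cast; ring] at h2
  refine HasDerivWithinAt.add ?_ h2
  by_cases h : j < ⌈β⌉₊
  · simp only [h, if_true]
    exact hasDerivWithinAt_const _ _ _
  · simp only [h, if_false]
    have hj : (⌈β⌉₊ : ℝ) ≤ j := by exact_mod_cast not_lt.1 h
    have h3 := hasDerivAt_Phi (s := (j : ℝ) + 1 + ((⌈β⌉₊ : ℝ) - β) - ((k + 1 : ℕ) : ℝ))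
      (by push_cast; linarith) t
    rw [show (j : ℝ) + 1 + ((⌈β⌉₊ : ℝ) - β) - ((k + 1 : ℕ) : ℝ) + 1
      = (j : ℝ) + 1 + ((⌈β⌉₊ : ℝ) - β) - (k : ℝ) by push_cast; ring] at h3
    exact h3.hasDerivWithinAt

lemma caputoDifferentiable_of_eqOn (hT : 0 < T) (hg : ContinuousOn g (Icc 0 T))
    (hf : EqOn f (fun t => Phi ((j : ℝ) + 1) t + fracIntegral α₀ g t) (Icc 0 T))
    {β : ℝ} (hβ : 0 ≤ β) (hβα : β ≤ α₀) : CaputoDifferentiable T β f := by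
  refine differentiableOn_iteratedDerivWithin_of_hasDerivWithinAt uniqueDiffOn_Ioc
    (F := fun k t => (if j < ⌈β⌉₊ then 0
        else Phi ((j : ℝ) + 1 + ((⌈β⌉₊ : ℝ) - β) - (k : ℝ)) t)
        + fracIntegral ((⌈β⌉₊ : ℝ) - β + α₀ - (k : ℝ)) g t) ?_ ?_
  · intro t ht
    simpa using rlIntegral_taylorRemainder_eqOn hT hg hf hβ hβα (Ioc_subset_Icc_self ht)
  · exact fun k hk t ht =>
      (hasDerivWithinAt_rlIntegral hg hβα hk (Ioc_subset_Icc_self ht)).mono Ioc_subset_Icc_self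

lemma caputoDeriv_of_eqOn (hT : 0 < T) (hg : ContinuousOn g (Icc 0 T))
    (hf : EqOn f (fun t => Phi ((j : ℝ) + 1) t + fracIntegral α₀ g t) (Icc 0 T))
    {β : ℝ} (hβ : 0 ≤ β) (hβα : β ≤ α₀) :
    EqOn (caputoDeriv T β f) (fun t => monomialDeriv j β t + fracIntegral (α₀ - β) g t)
      (Ioc 0 T) := by
  intro t ht
  have h := eqOn_iteratedDerivWithin_of_hasDerivWithinAt uniqueDiffOn_Ioc
    (f := fracIntegral ((⌈β⌉₊ : ℝ) - β) (taylorRemainder T ⌈β⌉₊ f))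
    (F := fun k t => (if j < ⌈β⌉₊ then 0
        else Phi ((j : ℝ) + 1 + ((⌈β⌉₊ : ℝ) - β) - (k : ℝ)) t)
        + fracIntegral ((⌈β⌉₊ : ℝ) - β + α₀ - (k : ℝ)) g t)
    (fun t ht => by
      simpa using rlIntegral_taylorRemainder_eqOn hT hg hf hβ hβα (Ioc_subset_Icc_self ht))
    (fun k hk t ht =>
      (hasDerivWithinAt_rlIntegral hg hβα hk (Ioc_subset_Icc_self ht)).mono Ioc_subset_Icc_self)
    ⌈β⌉₊ le_rfl ht
  rw [caputoDeriv, rlDeriv, h]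
  simp only [monomialDeriv, Nat.lt_ceil]
  congr 1
  · by_cases hb : (j : ℝ) < β
    · rw [if_pos hb, if_neg (not_le.2 hb)]
    · rw [if_neg hb, if_pos (not_lt.1 hb)]
      ring_nf
  · ring_nf

/-- At `β = α₀` the monomial part vanishes because `j < α₀`, and `I^0` is the identity. -/
lemma caputoDeriv_top_of_eqOn (hT : 0 < T) (hα : 0 ≤ α₀) (hj : j < ⌈α₀⌉₊)
    (hg : ContinuousOn g (Icc 0 T))
    (hf : EqOn f (fun t => Phi ((j : ℝ) + 1) t + fracIntegral α₀ g t) (Icc 0 T)) :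
    EqOn (caputoDeriv T α₀ f) g (Ioc 0 T) := by
  intro t ht
  rw [caputoDeriv_of_eqOn hT hg hf hα le_rfl ht]
  simp only
  rw [monomialDeriv, if_neg (not_le.2 (natCast_lt_of_lt_ceil hj)), sub_self, fracIntegral_zero,
    zero_add]

lemma memCaputoSpace_of_eqOn (hT : 0 < T) (hα : 0 < α₀) (hj : j < ⌈α₀⌉₊)
    (hg : ContinuousOn g (Icc 0 T))
    (hf : EqOn f (fun t => Phi ((j : ℝ) + 1) t + fracIntegral α₀ g t) (Icc 0 T)) :
    MemCaputoSpace T α₀ (⌈α₀⌉₊ - 1) f :=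
  ⟨contDiffOn_of_eqOn hT hα hg hf, caputoDifferentiable_of_eqOn hT hg hf hα.le le_rfl,
    g, hg, caputoDeriv_top_of_eqOn hT hα.le hj hg hf⟩

lemma tendstoInCaputoSpace_of_eqOn (hT : 0 < T) (hα : 0 < α₀) (hj : j < ⌈α₀⌉₊)
    {s G : ℕ → ℝ → ℝ} (hG : ∀ N, ContinuousOn (G N) (Icc 0 T))
    (hs : ∀ N, EqOn (s N) (fun t => Phi ((j : ℝ) + 1) t + fracIntegral α₀ (G N) t) (Icc 0 T))
    (hg : ContinuousOn g (Icc 0 T))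
    (hf : EqOn f (fun t => Phi ((j : ℝ) + 1) t + fracIntegral α₀ g t) (Icc 0 T))
    (hlim : TendstoUniformlyOn G g atTop (Icc 0 T)) :
    TendstoInCaputoSpace T α₀ (⌈α₀⌉₊ - 1) s f := by
  have hpos := Nat.ceil_pos.2 hα
  refine ⟨fun N => memCaputoSpace_of_eqOn hT hα hj (hG N) (hs N),
    memCaputoSpace_of_eqOn hT hα hj hg hf, fun k hk => ?_, ?_⟩
  · have hk' : k < ⌈α₀⌉₊ := by omega
    have h := tendstoUniformlyOn_fracIntegral (β := α₀ - k)
      (by linarith [natCast_lt_of_lt_ceil hk']) hG hg hlim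
    rw [Metric.tendstoUniformlyOn_iff] at h ⊢
    intro ε hε
    filter_upwards [h ε hε] with N hN t ht
    rw [eqOn_iteratedDerivWithin hT hg hf hk' ht,
      eqOn_iteratedDerivWithin hT (hG N) (hs N) hk' ht, dist_add_left]
    exact hN t ht
  · refine ((hlim.mono Ioc_subset_Icc_self).congr (Eventually.of_forall fun N t ht => ?_)).congr_right
      fun t ht => ?_
    · exact (caputoDeriv_top_of_eqOn hT hα.le hj (hG N) (hs N) ht).symm
    · exact (caputoDeriv_top_of_eqOn hT hα.le hj hg hf ht).symm

end Representation

/-! ### Every member of the space with monomial initial data has this form. -/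

lemma eqOn_fracIntegral_one {T : ℝ} {W g : ℝ → ℝ} (hW : ContinuousOn W (Icc 0 T))
    (hW0 : W 0 = 0) (hg : ContinuousOn g (Icc 0 T))
    (hd : ∀ t ∈ Ioo 0 T, HasDerivAt W (g t) t) : EqOn W (fracIntegral 1 g) (Icc 0 T) := by
  intro t ht
  have hsub : Icc 0 t ⊆ Icc 0 T := Icc_subset_Icc le_rfl ht.2
  rw [fracIntegral_one, intervalIntegral.integral_eq_sub_of_hasDerivAt_of_le ht.1 (hW.mono hsub)
    (fun x hx => hd x ⟨hx.1, hx.2.trans_le ht.2⟩), hW0, sub_zero]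
  refine (hg.mono ?_).intervalIntegrable
  rwa [uIcc_of_le ht.1]

lemma eqOn_of_eqOn_fracIntegral_one {T : ℝ} (hT : 0 < T) {v w : ℝ → ℝ}
    (hv : ContinuousOn v (Icc 0 T)) (hw : ContinuousOn w (Icc 0 T))
    (h : EqOn (fracIntegral 1 v) (fracIntegral 1 w) (Icc 0 T)) : EqOn v w (Icc 0 T) := by
  intro t ht
  exact (uniqueDiffOn_Icc hT t ht).eq_deriv _ (hasDerivWithinAt_fracIntegral_one hv ht)
    ((hasDerivWithinAt_fracIntegral_one hw ht).congr h (h ht))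

/-- A member of `C^{α, ⌈α⌉ - 1}[0, T]` with the initial data of `t ^ j / j!` is `t ^ j / j!` plus
the fractional integral of a continuous function. -/
lemma MemCaputoSpace.exists_eqOn {T α₀ : ℝ} {j : ℕ} {f : ℝ → ℝ} (hT : 0 < T) (hα : 0 < α₀)
    (hj : j < ⌈α₀⌉₊) (hf : MemCaputoSpace T α₀ (⌈α₀⌉₊ - 1) f)
    (hinit : ∀ k < ⌈α₀⌉₊, iteratedDerivWithin k f (Icc 0 T) 0 = if k = j then 1 else 0) :
    ∃ g, ContinuousOn g (Icc 0 T) ∧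
      EqOn f (fun t => Phi ((j : ℝ) + 1) t + fracIntegral α₀ g t) (Icc 0 T) := by
  obtain ⟨g, hg, hDg⟩ := hf.continuous_caputo
  refine ⟨g, hg, ?_⟩
  have hU := uniqueDiffOn_Icc hT
  have hn := hf.contDiffOn
  obtain ⟨p, hp⟩ : ∃ p, ⌈α₀⌉₊ = p + 1 := ⟨⌈α₀⌉₊ - 1, by have := Nat.ceil_pos.2 hα; omega⟩
  have hpα : (p : ℝ) < α₀ := natCast_lt_of_lt_ceil (by omega)
  have hαp : α₀ ≤ p + 1 := by
    have := Nat.le_ceil α₀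
    rw [hp] at this
    exact_mod_cast this
  rw [hp, Nat.add_sub_cancel] at hn
  -- `w k` is the `k`-th derivative of `f - Φ_{j+1}`. All of them vanish at `0` for `k ≤ p`, so
  -- integrating `p` times gives `w 0 = I^p (w p)`.
  set w : ℕ → ℝ → ℝ := fun k t => iteratedDerivWithin k f (Icc 0 T) t - monomialDeriv j (k : ℝ) t
    with hw
  have hwc (k : ℕ) (hk : k ≤ p) : ContinuousOn (w k) (Icc 0 T) :=
    (hn.continuousOn_iteratedDerivWithin (by exact_mod_cast hk) hU).sub
      (continuous_monomialDeriv _ _).continuousOn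
  have hw0 (k : ℕ) (hk : k ≤ p) : w k 0 = 0 := by
    simp only [hw]
    rw [hinit k (by omega), monomialDeriv_natCast_zero, sub_self]
  have hwd (k : ℕ) (hk : k < p) (t : ℝ) (ht : t ∈ Icc 0 T) :
      HasDerivWithinAt (w k) (w (k + 1) t) (Icc 0 T) t := by
    refine HasDerivWithinAt.sub ?_ (hasDerivAt_monomialDeriv j k t).hasDerivWithinAt
    rw [iteratedDerivWithin_succ]
    exact (hn.differentiableOn_iteratedDerivWithin (by exact_mod_cast hk) hU t
      ht).hasDerivWithinAt
  have hv := hwc p le_rfl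
  have hwI (i : ℕ) (hi : i ≤ p) : EqOn (w (p - i)) (fracIntegral (i : ℝ) (w p)) (Icc 0 T) := by
    induction i with
    | zero => simp [fracIntegral_zero, EqOn]
    | succ i ih =>
      have e : p - i = p - (i + 1) + 1 := by omega
      intro t ht
      have h1 := eqOn_fracIntegral_one (hwc (p - (i + 1)) (by omega)) (hw0 _ (by omega))
        (g := w (p - i)) (hwc _ (by omega)) (fun t ht => by
          rw [e]
          exact (hwd _ (by omega) t (Ioo_subset_Icc_self ht)).hasDerivAt
            (Icc_mem_nhds ht.1 ht.2)) ht
      rw [h1, fracIntegral_congr 1 (ih (by omega)) ht,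
        fracIntegral_fracIntegral zero_le_one i.cast_nonneg hv ht]
      push_cast
      ring_nf
  have hw0I : EqOn (w 0) (fracIntegral (p : ℝ) (w p)) (Icc 0 T) := by
    simpa using hwI p le_rfl
  have hfw (t : ℝ) : taylorRemainder T ⌈α₀⌉₊ f t = w 0 t := by
    rw [taylorRemainder_eq hinit, if_pos hj]
    simp [hw, monomialDeriv_zero]
  have hδ : 0 ≤ (⌈α₀⌉₊ : ℝ) - α₀ := sub_nonneg.2 (Nat.le_ceil _)
  set δ : ℝ := (⌈α₀⌉₊ : ℝ) - α₀ with hδdef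
  have hδp : δ = p + 1 - α₀ := by rw [hδdef, hp]; push_cast; ring
  set u := fracIntegral δ (taylorRemainder T ⌈α₀⌉₊ f) with hu
  have huE : EqOn u (fracIntegral (δ + p) (w p)) (Icc 0 T) := by
    intro t ht
    rw [hu, fracIntegral_congr δ (g := fracIntegral (p : ℝ) (w p))
      (fun τ hτ => by rw [hfw, hw0I hτ]) ht, fracIntegral_fracIntegral hδ p.cast_nonneg hv ht]
  have huD := eqOn_iteratedDerivWithin_of_hasDerivWithinAt uniqueDiffOn_Ioc (n := p)
    (f := u) (F := fun k => fracIntegral (δ + p - (k : ℝ)) (w p))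
    (fun t ht => by simpa using huE (Ioc_subset_Icc_self ht))
    (fun k hk t ht => by
      have hk1 : (k : ℝ) + 1 ≤ p := by exact_mod_cast hk
      have h := hasDerivWithinAt_fracIntegral (β := δ + p - ((k + 1 : ℕ) : ℝ))
        (by push_cast; linarith) hv (Ioc_subset_Icc_self ht)
      rw [show δ + p - ((k + 1 : ℕ) : ℝ) + 1 = δ + p - (k : ℝ) by push_cast; ring] at h
      exact h.mono Ioc_subset_Icc_self) p le_rfl
  simp only [add_sub_cancel_right] at huD
  have hWc := continuousOn_fracIntegral hδ hv
  have hW0 : fracIntegral δ (w p) 0 = 0 := by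
    by_cases h : δ = 0
    · rw [h, fracIntegral_zero, hw0 p le_rfl]
    · exact fracIntegral_apply_zero h _
  -- The `p`-th derivative of `u` is `I^δ (w p)`, which is continuous up to `0` and vanishes there;
  -- one more derivative gives `g` on the interior.
  have hWI : EqOn (fracIntegral δ (w p)) (fracIntegral 1 g) (Icc 0 T) := by
    refine eqOn_fracIntegral_one hWc hW0 hg fun t ht => ?_
    have hIoc : t ∈ Ioc 0 T := Ioo_subset_Ioc_self ht
    have h1 := (hf.caputoDifferentiable p (by omega) t hIoc).hasDerivWithinAt
    rw [← iteratedDerivWithin_succ, ← hp] at h1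
    have h2 : iteratedDerivWithin ⌈α₀⌉₊ u (Ioc 0 T) t = g t := hDg hIoc
    have h3 : HasDerivWithinAt (iteratedDerivWithin p u (Ioc 0 T)) (g t) (Ioc 0 T) t := by
      rw [← h2]; exact h1
    exact (h3.congr (fun x hx => (huD hx).symm) (huD hIoc).symm).hasDerivAt
      (Ioc_mem_nhds ht.1 ht.2)
  have hγ : 0 ≤ α₀ - p := by linarith
  -- Apply `I^{α₀ - p}` to the previous identity: since `α₀ - p + δ = 1`, both sides become images
  -- under `I^1`, which is injective on continuous functions.
  have hvg : EqOn (w p) (fracIntegral (α₀ - p) g) (Icc 0 T) := by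
    refine eqOn_of_eqOn_fracIntegral_one hT hv (continuousOn_fracIntegral hγ hg) fun t ht => ?_
    have h1 := fracIntegral_congr (α₀ - p) hWI ht
    rw [fracIntegral_fracIntegral hγ hδ hv ht, fracIntegral_fracIntegral hγ zero_le_one hg ht,
      hδp] at h1
    rw [fracIntegral_fracIntegral zero_le_one hγ hg ht]
    ring_nf at h1 ⊢
    exact h1
  intro t ht
  have h1 := hw0I ht
  rw [fracIntegral_congr _ hvg ht, fracIntegral_fracIntegral p.cast_nonneg hγ hg ht,
    add_sub_cancel] at h1
  simp only [hw, iteratedDerivWithin_zero, Nat.cast_zero, monomialDeriv_zero] at h1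
  simp only
  linarith

/-! ### The Volterra equation and its Neumann series. -/

section Volterra

variable {T : ℝ} {m : ℕ} {α : ℕ → ℝ} {a : ℕ → ℝ → ℝ}

lemma continuousOn_coeffOp (hα : ∀ i ∈ Finset.Icc 1 m, α i < α 0)
    (ha : ∀ i ∈ Finset.Icc 1 m, ContinuousOn (a i) (Icc 0 T)) {f : ℝ → ℝ}
    (hf : ContinuousOn f (Icc 0 T)) : ContinuousOn (coeffOp m α a f) (Icc 0 T) :=
  continuousOn_finsetSum _ fun i hi =>
    (ha i hi).mul (continuousOn_fracIntegral (sub_nonneg.2 (hα i hi).le) hf)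

lemma continuousOn_coeffOp_iterate (hα : ∀ i ∈ Finset.Icc 1 m, α i < α 0)
    (ha : ∀ i ∈ Finset.Icc 1 m, ContinuousOn (a i) (Icc 0 T)) {f : ℝ → ℝ}
    (hf : ContinuousOn f (Icc 0 T)) (k : ℕ) :
    ContinuousOn ((coeffOp m α a)^[k] f) (Icc 0 T) := by
  induction k with
  | zero => exact hf
  | succ k ih =>
    rw [Function.iterate_succ_apply']
    exact continuousOn_coeffOp hα ha ih

lemma coeffOp_sub (hα : ∀ i ∈ Finset.Icc 1 m, α i < α 0) {f g : ℝ → ℝ}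
    (hf : ContinuousOn f (Icc 0 T)) (hg : ContinuousOn g (Icc 0 T)) {t : ℝ} (ht : t ∈ Icc 0 T) :
    coeffOp m α a (fun τ => f τ - g τ) t = coeffOp m α a f t - coeffOp m α a g t := by
  simp only [coeffOp]
  rw [← Finset.sum_sub_distrib]
  refine Finset.sum_congr rfl fun i hi => ?_
  rw [fracIntegral_sub (sub_nonneg.2 (hα i hi).le) hf hg ht, mul_sub]

lemma coeffOp_finset_sum (hα : ∀ i ∈ Finset.Icc 1 m, α i < α 0) {ι : Type*} (S : Finset ι)
    (c : ι → ℝ) {f : ι → ℝ → ℝ} (hf : ∀ k ∈ S, ContinuousOn (f k) (Icc 0 T)) {t : ℝ}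
    (ht : t ∈ Icc 0 T) :
    coeffOp m α a (fun τ => ∑ k ∈ S, c k * f k τ) t = ∑ k ∈ S, c k * coeffOp m α a (f k) t := by
  simp only [coeffOp, Finset.mul_sum]
  rw [Finset.sum_comm]
  refine Finset.sum_congr rfl fun i hi => ?_
  rw [fracIntegral_finset_sum (sub_nonneg.2 (hα i hi).le) S c hf ht, Finset.mul_sum]
  exact Finset.sum_congr rfl fun k _ => by ring

/-- The weighted norm is at most `∑ C i * r^(-(α 0 - α i))` with `C i` a bound for `|a i|`; it tends
to `0` as `r → ∞` because every `α i < α 0` strictly. -/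
lemma exists_weight_coeffOp_le (hα : ∀ i ∈ Finset.Icc 1 m, α i < α 0)
    (ha : ∀ i ∈ Finset.Icc 1 m, ContinuousOn (a i) (Icc 0 T)) :
    ∃ r > 0, ∀ (M : ℝ) (f : ℝ → ℝ), (∀ t ∈ Icc 0 T, |f t| ≤ M * Real.exp (r * t)) →
      ∀ t ∈ Icc 0 T, |coeffOp m α a f t| ≤ M / 2 * Real.exp (r * t) := by
  have hC : ∀ i, ∃ C, i ∈ Finset.Icc 1 m → ∀ t ∈ Icc 0 T, |a i t| ≤ C := by
    intro i
    by_cases hi : i ∈ Finset.Icc 1 m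
    · obtain ⟨C, hC⟩ := isCompact_Icc.exists_bound_of_continuousOn (ha i hi)
      exact ⟨C, fun _ => hC⟩
    · exact ⟨0, fun h => absurd h hi⟩
  choose C hC using hC
  have hlim : Tendsto (fun r : ℝ => ∑ i ∈ Finset.Icc 1 m, C i * (1 / r) ^ (α 0 - α i)) atTop
      (𝓝 0) := by
    have h : Tendsto (fun r : ℝ => ∑ i ∈ Finset.Icc 1 m, C i * (1 / r) ^ (α 0 - α i)) atTop
        (𝓝 (∑ i ∈ Finset.Icc 1 m, C i * 0)) := by
      refine tendsto_finsetSum _ fun i hi => Tendsto.const_mul _ ?_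
      have hpos : 0 < α 0 - α i := sub_pos.2 (hα i hi)
      have h1 := (tendsto_inv_atTop_zero (𝕜 := ℝ)).rpow_const (p := α 0 - α i) (Or.inr hpos.le)
      rw [Real.zero_rpow hpos.ne'] at h1
      simpa [one_div] using h1
    simpa using h
  obtain ⟨r, hr, hr0⟩ := ((hlim.eventually_lt_const (show (0 : ℝ) < 1 / 2 by norm_num)).and
    (eventually_gt_atTop 0)).exists
  refine ⟨r, hr0, fun M f hf t ht => ?_⟩
  have hM : 0 ≤ M * Real.exp (r * t) := (abs_nonneg _).trans (hf t ht)
  calc |coeffOp m α a f t|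
      ≤ ∑ i ∈ Finset.Icc 1 m, |a i t * fracIntegral (α 0 - α i) f t| :=
        Finset.abs_sum_le_sum_abs _ _
    _ ≤ ∑ i ∈ Finset.Icc 1 m, C i * (M * Real.exp (r * t) * (1 / r) ^ (α 0 - α i)) := by
        refine Finset.sum_le_sum fun i hi => ?_
        rw [abs_mul]
        exact mul_le_mul (hC i hi t ht) (abs_fracIntegral_le (sub_nonneg.2 (hα i hi).le) hr0 ht.1
          fun τ hτ => hf τ ⟨hτ.1, hτ.2.trans ht.2⟩) (abs_nonneg _)
          ((abs_nonneg _).trans (hC i hi t ht))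
    _ = M * Real.exp (r * t) * ∑ i ∈ Finset.Icc 1 m, C i * (1 / r) ^ (α 0 - α i) := by
        rw [Finset.mul_sum]
        exact Finset.sum_congr rfl fun i _ => by ring
    _ ≤ M * Real.exp (r * t) * (1 / 2) := mul_le_mul_of_nonneg_left hr.le hM
    _ = M / 2 * Real.exp (r * t) := by ring

/-- Partial sum of the Neumann series of the equation `g = - h - A g`, where `A = coeffOp m α a`. -/
def neumannSum (m : ℕ) (α : ℕ → ℝ) (a : ℕ → ℝ → ℝ) (h : ℝ → ℝ) (N : ℕ) (t : ℝ) : ℝ :=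
  ∑ k ∈ Finset.range N, (-1 : ℝ) ^ (k + 1) * (coeffOp m α a)^[k] h t

lemma continuousOn_neumannSum (hα : ∀ i ∈ Finset.Icc 1 m, α i < α 0)
    (ha : ∀ i ∈ Finset.Icc 1 m, ContinuousOn (a i) (Icc 0 T)) {h : ℝ → ℝ}
    (hh : ContinuousOn h (Icc 0 T)) (N : ℕ) :
    ContinuousOn (neumannSum m α a h N) (Icc 0 T) :=
  continuousOn_finsetSum _ fun k _ =>
    continuousOn_const.mul (continuousOn_coeffOp_iterate hα ha hh k)

lemma exists_abs_le_mul_exp {r : ℝ} (hr : 0 < r) {f : ℝ → ℝ} (hf : ContinuousOn f (Icc 0 T)) :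
    ∃ M, ∀ t ∈ Icc 0 T, |f t| ≤ M * Real.exp (r * t) := by
  obtain ⟨M, hM⟩ := isCompact_Icc.exists_bound_of_continuousOn hf
  refine ⟨M, fun t ht => (hM t ht).trans (le_mul_of_one_le_right
    ((norm_nonneg _).trans (hM t ht)) (Real.one_le_exp (mul_nonneg hr.le ht.1)))⟩

/-- Peeling off the term `k = 0` leaves `-A` applied to the previous sum; in the limit this
recursion becomes the equation. -/
lemma neumannSum_succ (hα : ∀ i ∈ Finset.Icc 1 m, α i < α 0)
    (ha : ∀ i ∈ Finset.Icc 1 m, ContinuousOn (a i) (Icc 0 T)) {h : ℝ → ℝ}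
    (hh : ContinuousOn h (Icc 0 T)) (N : ℕ) {t : ℝ} (ht : t ∈ Icc 0 T) :
    neumannSum m α a h (N + 1) t = -h t - coeffOp m α a (neumannSum m α a h N) t := by
  have e : coeffOp m α a (neumannSum m α a h N) t
      = ∑ k ∈ Finset.range N, (-1 : ℝ) ^ (k + 1) * (coeffOp m α a)^[k + 1] h t := by
    simp_rw [Function.iterate_succ_apply']
    exact coeffOp_finset_sum hα _ _ (fun k _ => continuousOn_coeffOp_iterate hα ha hh k) ht
  rw [e, neumannSum, Finset.sum_range_succ', sub_eq_add_neg, ← Finset.sum_neg_distrib, add_comm]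
  congr 1
  · simp
  · exact Finset.sum_congr rfl fun k _ => by ring

lemma exists_solution (hα : ∀ i ∈ Finset.Icc 1 m, α i < α 0)
    (ha : ∀ i ∈ Finset.Icc 1 m, ContinuousOn (a i) (Icc 0 T)) {h : ℝ → ℝ}
    (hh : ContinuousOn h (Icc 0 T)) :
    ∃ g, ContinuousOn g (Icc 0 T) ∧
      TendstoUniformlyOn (neumannSum m α a h) g atTop (Icc 0 T) ∧
      EqOn g (fun t => -h t - coeffOp m α a g t) (Icc 0 T) := by
  obtain ⟨r, hr, hA⟩ := exists_weight_coeffOp_le hα ha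
  obtain ⟨M, hM⟩ := exists_abs_le_mul_exp hr hh
  have hit (k : ℕ) : ∀ t ∈ Icc 0 T,
      |(coeffOp m α a)^[k] h t| ≤ M / 2 ^ k * Real.exp (r * t) := by
    induction k with
    | zero => simpa using hM
    | succ k ih =>
      rw [Function.iterate_succ_apply', pow_succ, ← div_div]
      exact hA _ _ ih
  have hsum : Summable fun k : ℕ => |M| * Real.exp (r * T) * (1 / 2 : ℝ) ^ k :=
    summable_geometric_two.mul_left _
  have hu := tendstoUniformlyOn_tsum_nat
    (f := fun k t => (-1 : ℝ) ^ (k + 1) * (coeffOp m α a)^[k] h t) hsum (s := Icc 0 T)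
    fun k t ht => by
      rw [norm_mul, norm_pow, norm_neg, norm_one, one_pow, one_mul, Real.norm_eq_abs]
      refine (hit k t ht).trans ?_
      have h1 : Real.exp (r * t) ≤ Real.exp (r * T) :=
        Real.exp_le_exp.2 (mul_le_mul_of_nonneg_left ht.2 hr.le)
      calc M / 2 ^ k * Real.exp (r * t) ≤ |M| / 2 ^ k * Real.exp (r * T) := by
            gcongr
            exact le_abs_self M
        _ = |M| * Real.exp (r * T) * (1 / 2 : ℝ) ^ k := by rw [one_div, inv_pow]; ring
  have hlim : TendstoUniformlyOn (neumannSum m α a h) _ atTop (Icc 0 T) := hu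
  have hc := continuousOn_neumannSum hα ha hh
  have hg := hlim.continuousOn (Frequently.of_forall hc)
  refine ⟨_, hg, hlim, fun t ht => ?_⟩
  have h1 := (hlim.tendsto_at ht).comp (tendsto_add_atTop_nat 1)
  refine tendsto_nhds_unique h1 ?_
  have h2 : Tendsto (fun N => -h t - coeffOp m α a (neumannSum m α a h N) t) atTop
      (𝓝 (-h t - coeffOp m α a _ t)) :=
    Tendsto.const_sub _ (tendsto_finsetSum _ fun i hi => Tendsto.const_mul _
      ((tendstoUniformlyOn_fracIntegral (sub_nonneg.2 (hα i hi).le) hc hg hlim).tendsto_at ht))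
  exact h2.congr fun N => (neumannSum_succ hα ha hh N ht).symm

/-- The difference `d` of two solutions satisfies `d = -A d`, so its weighted bound can be halved
indefinitely. -/
lemma eqOn_of_solution (hα : ∀ i ∈ Finset.Icc 1 m, α i < α 0)
    (ha : ∀ i ∈ Finset.Icc 1 m, ContinuousOn (a i) (Icc 0 T)) {h g₁ g₂ : ℝ → ℝ}
    (hg₁ : ContinuousOn g₁ (Icc 0 T)) (hg₂ : ContinuousOn g₂ (Icc 0 T))
    (h₁ : EqOn g₁ (fun t => -h t - coeffOp m α a g₁ t) (Icc 0 T))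
    (h₂ : EqOn g₂ (fun t => -h t - coeffOp m α a g₂ t) (Icc 0 T)) : EqOn g₁ g₂ (Icc 0 T) := by
  obtain ⟨r, hr, hA⟩ := exists_weight_coeffOp_le hα ha
  obtain ⟨M, hM⟩ := exists_abs_le_mul_exp hr (hg₁.sub hg₂)
  have hit (k : ℕ) : ∀ t ∈ Icc 0 T, |g₁ t - g₂ t| ≤ M / 2 ^ k * Real.exp (r * t) := by
    induction k with
    | zero => simpa using hM
    | succ k ih =>
      intro t ht
      have h3 := hA _ _ ih t ht
      rw [coeffOp_sub hα hg₁ hg₂ ht] at h3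
      rw [h₁ ht, h₂ ht, pow_succ, ← div_div]
      convert h3 using 1
      rw [abs_sub_comm]
      ring_nf
  intro t ht
  have hlim : Tendsto (fun k : ℕ => M / 2 ^ k * Real.exp (r * t)) atTop (𝓝 0) := by
    have := ((tendsto_pow_atTop_nhds_zero_of_lt_one (r := (1 / 2 : ℝ)) (by norm_num)
      (by norm_num)).const_mul M).mul_const (Real.exp (r * t))
    simp only [mul_zero, zero_mul] at this
    refine this.congr fun k => ?_
    rw [one_div, inv_pow]
    ring
  have h0 := ge_of_tendsto' hlim fun k => hit k t ht
  exact sub_eq_zero.1 (abs_nonpos_iff.1 h0)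

/-- The function `∑_{i=1}^m a_i D^{α_i} (t ^ j / j!)`. -/
def monomialForcing (m : ℕ) (α : ℕ → ℝ) (a : ℕ → ℝ → ℝ) (j : ℕ) (t : ℝ) : ℝ :=
  ∑ i ∈ Finset.Icc 1 m, a i t * monomialDeriv j (α i) t

lemma continuousOn_monomialForcing (ha : ∀ i ∈ Finset.Icc 1 m, ContinuousOn (a i) (Icc 0 T))
    (j : ℕ) : ContinuousOn (monomialForcing m α a j) (Icc 0 T) :=
  continuousOn_finsetSum _ fun i hi =>
    (ha i hi).mul (continuous_monomialDeriv j (α i)).continuousOn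

lemma innerSum_eq_monomialForcing {p j : ℕ} (hp : 1 ≤ p)
    (h : ∀ i ∈ Finset.Icc 1 m, α i ≤ (j : ℝ) ↔ p ≤ i) :
    innerSum m α a p j = monomialForcing m α a j := by
  funext t
  rw [innerSum, monomialForcing, ← Finset.sum_subset (Finset.Icc_subset_Icc_left hp)]
  · refine Finset.sum_congr rfl fun i hi => ?_
    have hi' := Finset.mem_Icc.1 hi
    rw [monomialDeriv, if_pos ((h i (Finset.mem_Icc.2 ⟨hp.trans hi'.1, hi'.2⟩)).2 hi'.1)]
  · intro i hi hip
    have hi' := Finset.mem_Icc.1 hi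
    rw [monomialDeriv, if_neg, mul_zero]
    rw [h i hi]
    exact fun hpi => hip (Finset.mem_Icc.2 ⟨hpi, hi'.2⟩)

lemma partialSum_eqOn (h0 : 0 ≤ α 0) (hα : ∀ i ∈ Finset.Icc 1 m, α i < α 0)
    (ha : ∀ i ∈ Finset.Icc 1 m, ContinuousOn (a i) (Icc 0 T)) {p j : ℕ}
    (h : innerSum m α a p j = monomialForcing m α a j) (N : ℕ) :
    EqOn (partialSum m α a p j N) (fun t => Phi ((j : ℝ) + 1) t
      + fracIntegral (α 0) (neumannSum m α a (monomialForcing m α a j) N) t) (Icc 0 T) := by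
  intro t ht
  simp only [partialSum]
  rw [h]
  congr 1
  exact (fracIntegral_finset_sum h0 _ _ (fun k _ => continuousOn_coeffOp_iterate hα ha
    (continuousOn_monomialForcing ha j) k) ht).symm

lemma caputoDeriv_sum_eq (hT : 0 < T) (hα : ∀ i ∈ Finset.Icc 1 m, α i < α 0)
    (hα0 : ∀ i ∈ Finset.Icc 1 m, 0 ≤ α i) {j : ℕ} {f g : ℝ → ℝ} (hg : ContinuousOn g (Icc 0 T))
    (hf : EqOn f (fun t => Phi ((j : ℝ) + 1) t + fracIntegral (α 0) g t) (Icc 0 T))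
    {t : ℝ} (ht : t ∈ Ioc 0 T) :
    ∑ i ∈ Finset.Icc 1 m, a i t * caputoDeriv T (α i) f t
      = monomialForcing m α a j t + coeffOp m α a g t := by
  rw [monomialForcing, coeffOp, ← Finset.sum_add_distrib]
  refine Finset.sum_congr rfl fun i hi => ?_
  rw [caputoDeriv_of_eqOn hT hg hf (hα0 i hi) (hα i hi).le ht, mul_add]

end Volterra

end CaputoFDE

end

/-! ### Existence, uniqueness and the three formulas. -/

theorem theorem4 (T : ℝ) (hT : 0 < T) (m : ℕ) (α : ℕ → ℝ) (n : ℕ → ℕ) (a : ℕ → ℝ → ℝ)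
    (hα : ∀ i j, i < j → j ≤ m → α j < α i) (hαm : 0 ≤ α m)
    (hn : ∀ i ≤ m, (n i : ℝ) - 1 < α i ∧ α i ≤ (n i : ℝ))
    (hn01 : n 1 < n 0)
    (ha : ∀ i, 1 ≤ i → i ≤ m → ContinuousOn (a i) (Set.Icc 0 T))
    (j₀ : ℕ) (hj₀ : j₀ + 2 ≤ n 0)
    (hH₀ : CaputoFDE.indexSet m α j₀ = ∅)
    (hH₁ : (CaputoFDE.indexSet m α (j₀ + 1)).Nonempty) :
    ∃ y : Fin (n 0) → ℝ → ℝ,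
      CaputoFDE.IsCanonicalFundamentalSystem T m α a (n 0) y ∧
      (∀ z : Fin (n 0) → ℝ → ℝ, CaputoFDE.IsCanonicalFundamentalSystem T m α a (n 0) z →
        ∀ j, Set.EqOn (z j) (y j) (Set.Icc 0 T)) ∧
      (∀ j : Fin (n 0), (j : ℕ) ≤ j₀ →
        Set.EqOn (y j) (CaputoFDE.Phi ((j : ℝ) + 1)) (Set.Icc 0 T)) ∧
      (∀ j : Fin (n 0), j₀ < (j : ℕ) → (j : ℕ) < n 1 →
        CaputoFDE.TendstoInCaputoSpace T (α 0) (n 0 - 1)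
          (CaputoFDE.partialSum m α a (CaputoFDE.minIndex m α j) j) (y j)) ∧
      (∀ j : Fin (n 0), n 1 ≤ (j : ℕ) →
        CaputoFDE.TendstoInCaputoSpace T (α 0) (n 0 - 1)
          (CaputoFDE.partialSum m α a 1 j) (y j)) := by
  open CaputoFDE in
  have hα' : ∀ i ∈ Finset.Icc 1 m, α i < α 0 := fun i hi => by
    have := Finset.mem_Icc.1 hi
    exact hα 0 i (by omega) this.2
  have hanti (i j : ℕ) (hij : i ≤ j) (hj : j ≤ m) : α j ≤ α i := by
    rcases hij.eq_or_lt with rfl | h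
    · exact le_rfl
    · exact (hα i j h hj).le
  have hnn : ∀ i ≤ m, 0 ≤ α i := fun i hi => hαm.trans (hanti i m hi le_rfl)
  have hnn' : ∀ i ∈ Finset.Icc 1 m, 0 ≤ α i := fun i hi => hnn i (Finset.mem_Icc.1 hi).2
  have ha' : ∀ i ∈ Finset.Icc 1 m, ContinuousOn (a i) (Icc 0 T) := fun i hi =>
    ha i (Finset.mem_Icc.1 hi).1 (Finset.mem_Icc.1 hi).2
  have hn0 := hn 0 m.zero_le
  have hα0 : 0 < α 0 := by
    have : ((j₀ + 2 : ℕ) : ℝ) ≤ n 0 := by exact_mod_cast hj₀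
    push_cast at this
    linarith [hn0.1, j₀.cast_nonneg (α := ℝ)]
  have hceil : ⌈α 0⌉₊ = n 0 := by
    refine (Nat.ceil_eq_iff (by omega)).2 ⟨?_, hn0.2⟩
    rw [Nat.cast_sub (by omega), Nat.cast_one]
    exact hn0.1
  have hpred : n 0 - 1 = ⌈α 0⌉₊ - 1 := by rw [hceil]
  have hjc (j : Fin (n 0)) : (j : ℕ) < ⌈α 0⌉₊ := by rw [hceil]; exact j.2
  choose g hg hlim hsol using fun j : ℕ =>
    exists_solution hα' ha' (continuousOn_monomialForcing (α := α) ha' j)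
  have heq (j : Fin (n 0)) : EqOn (fun t => Phi ((j : ℝ) + 1) t + fracIntegral (α 0) (g j) t)
      (fun t => Phi ((j : ℝ) + 1) t + fracIntegral (α 0) (g j) t) (Icc 0 T) := fun _ _ => rfl
  have hclose : closure (Ioo 0 T) = Icc 0 T := closure_Ioo hT.ne
  have hconv (j : Fin (n 0)) (p : ℕ)
      (hp : innerSum m α a p j = monomialForcing m α a j) :
      TendstoInCaputoSpace T (α 0) (n 0 - 1) (partialSum m α a p j)
        (fun t => Phi ((j : ℝ) + 1) t + fracIntegral (α 0) (g j) t) := by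
    rw [hpred]
    exact tendstoInCaputoSpace_of_eqOn hT hα0 (hjc j)
      (continuousOn_neumannSum hα' ha' (continuousOn_monomialForcing ha' j))
      (partialSum_eqOn hα0.le hα' ha' hp) (hg j) (heq j) (hlim j)
  refine ⟨fun j t => Phi ((j : ℝ) + 1) t + fracIntegral (α 0) (g j) t, ?_, ?_, ?_, ?_, ?_⟩
  · refine ⟨fun j => ?_, fun j i hi => ?_, fun j t ht => ?_, fun j k => ?_⟩
    · rw [hpred]
      exact memCaputoSpace_of_eqOn hT hα0 (hjc j) (hg j) (heq j)
    · exact caputoDifferentiable_of_eqOn hT (hg j) (heq j) (hnn i hi) (hanti 0 i i.zero_le hi)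
    · have ht' := Ioo_subset_Ioc_self ht
      rw [caputoDeriv_sum_eq hT hα' hnn' (hg j) (heq j) ht',
        caputoDeriv_top_of_eqOn hT hα0.le (hjc j) (hg j) (heq j) ht',
        hsol j (Ioo_subset_Icc_self ht)]
      ring
    · rw [iteratedDerivWithin_zero_of_eqOn hT (hg j) (heq j) (hjc k)]
      simp only [Fin.ext_iff, eq_comm]
  · intro z hz j
    have hmem := hz.mem j
    rw [hpred] at hmem
    obtain ⟨w, hw, hzw⟩ := hmem.exists_eqOn hT hα0 (hjc j) fun k hk => by
      have := hz.initial j ⟨k, by omega⟩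
      simpa only [Fin.ext_iff, eq_comm] using this
    -- The equation is given only on `(0, T)`; continuity of both sides extends it to `[0, T]`.
    have hwsol : EqOn w (fun t => -monomialForcing m α a j t - coeffOp m α a w t) (Icc 0 T) := by
      refine EqOn.of_subset_closure (s := Ioo 0 T) (fun t ht => ?_) hw
        ((continuousOn_monomialForcing ha' j).neg.sub (continuousOn_coeffOp hα' ha' hw))
        Ioo_subset_Icc_self hclose.ge
      have ht' := Ioo_subset_Ioc_self ht
      have h := hz.equation j t ht
      rw [caputoDeriv_sum_eq hT hα' hnn' hw hzw ht',
        caputoDeriv_top_of_eqOn hT hα0.le (hjc j) hw hzw ht'] at h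
      simp only [h]
      ring
    have hwg := eqOn_of_solution hα' ha' hw (hg j) hwsol (hsol j)
    intro t ht
    rw [hzw ht]
    simp only [fracIntegral_congr (α 0) hwg ht]
  · intro j hj t ht
    -- `H_{j₀} = ∅` leaves no `α i ≤ j`, so the forcing vanishes and uniqueness gives `g j = 0`.
    have hforce : monomialForcing m α a j = fun _ => 0 := by
      funext t
      refine Finset.sum_eq_zero fun i hi => ?_
      have hi' := Finset.mem_Icc.1 hi
      rw [monomialDeriv, if_neg, mul_zero]
      intro hij
      have : i ∈ indexSet m α j₀ :=
        ⟨hi'.1, hi'.2, hnn i hi'.2, hij.trans (by exact_mod_cast hj)⟩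
      simp [hH₀] at this
    have hzero (β : ℝ) (t : ℝ) : fracIntegral β (fun _ => 0) t = 0 := by
      simp [fracIntegral]
    have hg0 := eqOn_of_solution hα' ha' (hg j) (continuousOn_const (c := (0 : ℝ))) (hsol j)
      (fun t _ => by simp [hforce, coeffOp, hzero])
    simp only [fracIntegral_congr (α 0) hg0 ht, hzero, add_zero]
  · intro j hj _
    refine hconv j _ ?_
    obtain ⟨i₁, h₁, h₂, h₃, h₄⟩ := hH₁
    -- `H_{j₀+1} ⊆ H_j`, so the minimum is attained. As `α` decreases, `α i ≤ j` exactly when `i ≥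
    -- h_j`.
    have hne : (indexSet m α j).Nonempty :=
      ⟨i₁, h₁, h₂, h₃, h₄.trans (by exact_mod_cast hj)⟩
    obtain ⟨hp1, hpm, -, hpj⟩ : minIndex m α j ∈ indexSet m α j := Nat.sInf_mem hne
    refine innerSum_eq_monomialForcing hp1 fun i hi => ⟨fun h => ?_, fun h => ?_⟩
    · exact Nat.sInf_le ⟨(Finset.mem_Icc.1 hi).1, (Finset.mem_Icc.1 hi).2, hnn' i hi, h⟩
    · exact (hanti _ i h (Finset.mem_Icc.1 hi).2).trans hpj
  · intro j hj
    refine hconv j 1 (innerSum_eq_monomialForcing le_rfl fun i hi =>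
      iff_of_true ?_ (Finset.mem_Icc.1 hi).1)
    have hi' := Finset.mem_Icc.1 hi
    calc α i ≤ α 1 := hanti 1 i hi'.1 hi'.2
      _ ≤ n 1 := (hn 1 (hi'.1.trans hi'.2)).2
      _ ≤ j := by exact_mod_cast hj
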